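/- Let $m\ge 0$ be a fixed integer and let $\mu$ be an arbitrary probability distribution on $\mathbb{F}_2^m$. For every $n=2^k$, $k=0,1,2,\dots$, let $X=X^{(n)}$ be an $m\times n$ random matrix over $\mathbb{F}_2$ whose columns are i.i.d. with distribution $\mu$, and let $Y=XG_n$ (multiplication over $\mathbb{F}_2$), where $G_n=\begin{bmatrix}1&0\\1&1\end{bmatrix}^{\otimes k}$ is the $k$-fold Kronecker power. Write $Y_j$ for the $j$-th column of $Y$, $Y_j[S]$ for the vector of the entries of $Y_j$ with row index in $S\subseteq[m]=\{1,\dots,m\}$, and $Y^{j-1}=[Y_1,\dots,Y_{j-1}]$; let $$H(U\mid V)=\sum_v P(V=v)\sum_u P(U=u\mid V=v)\log_2\frac{1}{P(U=u\mid V=v)}$$ be the conditional entropy in bits (with $0\log_2(1/0)=0$, the outer sum being over those $v$ with $P(V=v)>0$), and let $\{0,1,\dots,r\}\pm\varepsilon=\bigcup_{t=0}^{r}[t-\varepsilon,t+\varepsilon]$. Then for every $\varepsilon>0$, $$\frac1n\,\Bigl|\bigl\{j\in\{1,\dots,n\}:\ H(Y_j[S]\mid Y^{j-1})\in\{0,1,\dots,|S|\}\pm\varepsilon\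 \text{ for all } S\subseteq[m]\bigr\}\Bigr|\longrightarrow 1$$ as $n\to\infty$ through the powers of $2$. -/

import Mathlib

open MeasureTheory ProbabilityTheory Filter Topology
open scoped Kronecker

noncomputable section

namespace MatrixPolar

/-- The conditional entropy `H(X | Y) = ∑_y (∑_x p(x|y) log₂ (1 / p(x|y))) p(y)`, in bits, of random
variables with finitely many values, where `p(x|y) = P(X = x, Y = y) / P(Y = y)`. -/
def condEntropy {Ω α β : Type*} [MeasurableSpace Ω] [Fintype α] [Fintype β]
    (P : Measure Ω) (X : Ω → α) (Y : Ω → β) : ℝ :=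
  ∑ y : β, (∑ x : α,
    (P.real (X ⁻¹' {x} ∩ Y ⁻¹' {y}) / P.real (Y ⁻¹' {y})) *
      Real.logb 2 (1 / (P.real (X ⁻¹' {x} ∩ Y ⁻¹' {y}) / P.real (Y ⁻¹' {y})))) *
    P.real (Y ⁻¹' {y})

/-- The kernel matrix `[[1, 0], [1, 1]]` over `𝔽₂`. -/
def kernelMatrix : Matrix (Fin 2) (Fin 2) (ZMod 2) := !![1, 0; 1, 1]

/-- `polarMatrix k` is the `k`-fold Kronecker power of `kernelMatrix`, with rows and columns numbered
`0, …, 2 ^ k - 1` as usual: the row `(a, b)` of `A ⊗ B` is the row number `a * 2 ^ k + b`. -/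
def polarMatrix : (k : ℕ) → Matrix (Fin (2 ^ k)) (Fin (2 ^ k)) (ZMod 2)
  | 0 => 1
  | k + 1 =>
    Matrix.reindex (finProdFinEquiv.trans (finCongr (pow_succ' 2 k).symm))
      (finProdFinEquiv.trans (finCongr (pow_succ' 2 k).symm))
      (kernelMatrix ⊗ₖ polarMatrix k)

/-- The random vector `Y_j[S]`: the entries of column `j` with row index in `S`. -/
def colRestrict {Ω : Type*} {m n : ℕ} (Y : Ω → Matrix (Fin m) (Fin n) (ZMod 2))
    (j : Fin n) (S : Finset (Fin m)) : Ω → (S → ZMod 2) :=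
  fun ω i => Y ω i j

/-- The random list of columns `Y^{j-1}`: all the columns that strictly precede column `j`. -/
def pastCols {Ω : Type*} {m n : ℕ} (Y : Ω → Matrix (Fin m) (Fin n) (ZMod 2))
    (j : Fin n) : Ω → ({l : Fin n // l < j} → Fin m → ZMod 2) :=
  fun ω l i => Y ω i l

/-- The set `{0, 1, …, r} ± ε`. -/
def nearIntegers (r : ℕ) (ε : ℝ) : Set ℝ :=
  {x | ∃ t : ℕ, t ≤ r ∧ x ∈ Set.Icc ((t : ℝ) - ε) ((t : ℝ) + ε)}

/-- The set of the column indices `j` with `H(Y_j[S] | Y^{j-1}) ∈ {0, 1, …, |S|} ± ε` for all sets of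
rows `S`. -/
def polarizedCols {Ω : Type*} [MeasurableSpace Ω] {m n : ℕ} (P : Measure Ω)
    (Y : Ω → Matrix (Fin m) (Fin n) (ZMod 2)) (ε : ℝ) : Set (Fin n) :=
  {j | ∀ S : Finset (Fin m),
    condEntropy P (colRestrict Y j S) (pastCols Y j) ∈ nearIntegers S.card ε}

end MatrixPolar

end

/-! Fix a set of rows `S` and let `π` be the restriction of a column to `S`. One polarization step
turns a source `U` with side information `V` into two: `U₁ + U₂` given `V₁, V₂` ("minus"), and `U₂`
given `V₁, V₂, U₁ + U₂` ("plus"). The block form of the Kronecker power shows that the conditional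
entropy of `Y_j[S]` is the entropy of `π U` for the source reached by following the binary digits of
the column number counted from 0 (`polarEnt_eq_leaf`).

Let `h` be the entropy of `π U` given the side information. It does not decrease under minus, and
the two new values sum to at most `2h` (`ent_minus_add_plus_le`). So along random digits `h` is a
bounded supermartingale, and a quadratic potential shows that the mean square of the minus increment
tends to 0 (`tendsto_avg_sq_gap`).

A small increment forces `h` to be near a multiple of `log 2`. If convolving two laws does not raise
the entropy, equality in Jensen's inequality makes them uniform on cosets of a subgroup, whose order
is a power of 2 (`exists_massEnt_eq_log_card`). Compactness of the simplex makes this quantitative,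
and averaging over the side information carries it to conditional entropies with a constant
independent of the alphabet of `V` (`exists_infDist_condShannon_le`). Hence the proportion of bad
columns vanishes for each `S`, and a union bound over the finitely many `S` finishes. -/

namespace MatrixPolar

/-! ### Entropy of finite mass functions. -/

section Shannon

variable {Ω α β γ : Type*} [Fintype Ω]

open scoped Classical in
/-- The image of the mass function `p` under `f`. -/
noncomputable def push (p : Ω → ℝ) (f : Ω → α) (a : α) : ℝ := ∑ ω, if f ω = a then p ω else 0

/-- The entropy, in nats, of `f` under the mass function `p`. -/
noncomputable def shannon (p : Ω → ℝ) (f : Ω → α) : ℝ :=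
  -∑ ω, p ω * Real.log (push p f (f ω))

/-- The conditional entropy, in nats, of `f` given `g` under the mass function `p`. -/
noncomputable def condShannon (p : Ω → ℝ) (f : Ω → α) (g : Ω → β) : ℝ :=
  shannon p (fun ω => (f ω, g ω)) - shannon p g

/-- The product mass function of two copies of `p`. -/
def sqMass (p : Ω → ℝ) (x : Ω × Ω) : ℝ := p x.1 * p x.2

theorem push_nonneg {p : Ω → ℝ} (hp : ∀ ω, 0 ≤ p ω) (f : Ω → α) (a : α) : 0 ≤ push p f a := by
  unfold push
  exact Finset.sum_nonneg fun ω _ => by split_ifs; exacts [hp ω, le_rfl]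

theorem sum_push_mul [Fintype α] (p : Ω → ℝ) (f : Ω → α) (F : α → ℝ) :
    ∑ a, push p f a * F a = ∑ ω, p ω * F (f ω) := by
  classical
  simp only [push, Finset.sum_mul, ite_mul, zero_mul]
  rw [Finset.sum_comm]
  simp

theorem sum_push [Fintype α] (p : Ω → ℝ) (f : Ω → α) : ∑ a, push p f a = ∑ ω, p ω := by
  simpa using sum_push_mul p f (fun _ => 1)

theorem push_push [Fintype α] (p : Ω → ℝ) (f : Ω → α) (g : α → β) :
    push (push p f) g = push p (fun ω => g (f ω)) := by
  classical
  funext b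
  have := sum_push_mul p f (fun a => if g a = b then 1 else 0)
  simpa [push] using this

theorem push_id (p : Ω → ℝ) : push p (fun ω => ω) = p := by
  classical
  funext a
  simp [push]

theorem shannon_push [Fintype α] (p : Ω → ℝ) (f : Ω → α) (g : α → β) :
    shannon (push p f) g = shannon p (fun ω => g (f ω)) := by
  unfold shannon
  rw [push_push, sum_push_mul p f (fun a => Real.log (push p (fun ω => g (f ω)) (g a)))]

theorem condShannon_push [Fintype α] (p : Ω → ℝ) (φ : Ω → α) (f : α → β) (g : α → γ) :
    condShannon (push p φ) f g = condShannon p (fun ω => f (φ ω)) (fun ω => g (φ ω)) := by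
  unfold condShannon
  rw [shannon_push, shannon_push]

theorem shannon_eq_sum [Fintype α] (p : Ω → ℝ) (f : Ω → α) :
    shannon p f = ∑ a, Real.negMulLog (push p f a) := by
  unfold shannon
  rw [← sum_push_mul p f (fun a => Real.log (push p f a)), ← Finset.sum_neg_distrib]
  simp [Real.negMulLog]

/-- Entropy sees only the partition of `Ω` into fibres. This is the tool for re-encoding variables
below. -/
theorem shannon_congr (p : Ω → ℝ) {f : Ω → α} {g : Ω → β}
    (h : ∀ ω ω', f ω = f ω' ↔ g ω = g ω') : shannon p f = shannon p g := by
  classical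
  unfold shannon push
  simp only [h]

theorem condShannon_congr {α' β' : Type*} (p : Ω → ℝ) {f : Ω → α} {g : Ω → β}
    {f' : Ω → α'} {g' : Ω → β'} (hf : ∀ ω ω', g ω = g ω' → (f ω = f ω' ↔ f' ω = f' ω'))
    (hg : ∀ ω ω', g ω = g ω' ↔ g' ω = g' ω') : condShannon p f g = condShannon p f' g' := by
  unfold condShannon
  rw [shannon_congr p hg, shannon_congr p (g := fun ω => (f' ω, g' ω))]
  intro ω ω'
  simp only [Prod.mk.injEq]
  rw [← hg]
  constructor
  · rintro ⟨h1, h2⟩; exact ⟨(hf _ _ h2).1 h1, h2⟩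
  · rintro ⟨h1, h2⟩; exact ⟨(hf _ _ h2).2 h1, h2⟩

theorem push_fst_eq [Fintype α] [Fintype β] (q : α × β → ℝ) (a : α) :
    push q Prod.fst a = ∑ b, q (a, b) := by
  classical
  simp only [push, Fintype.sum_prod_type]
  rw [Finset.sum_comm]
  simp

theorem push_snd_eq [Fintype α] [Fintype β] (q : α × β → ℝ) (b : β) :
    push q Prod.snd b = ∑ a, q (a, b) := by
  classical
  simp [push, Fintype.sum_prod_type]

/-- Subadditivity of the entropy for an unnormalized joint mass function. -/
theorem sum_negMulLog_add_le [Fintype α] [Fintype γ] (t : α → γ → ℝ) (ht : ∀ x z, 0 ≤ t x z) :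
    ∑ x, ∑ z, Real.negMulLog (t x z) + Real.negMulLog (∑ x, ∑ z, t x z) ≤
      ∑ x, Real.negMulLog (∑ z, t x z) + ∑ z, Real.negMulLog (∑ x, t x z) := by
  set r : α → ℝ := fun x => ∑ z, t x z with hr
  set c : γ → ℝ := fun z => ∑ x, t x z with hc
  set s : ℝ := ∑ x, ∑ z, t x z with hs
  have hrs : ∑ x, r x = s := rfl
  have hcs : ∑ z, c z = s := by rw [hs, Finset.sum_comm]
  have r0 : ∀ x, 0 ≤ r x := fun x => Finset.sum_nonneg fun z _ => ht x z
  have c0 : ∀ z, 0 ≤ c z := fun z => Finset.sum_nonneg fun x _ => ht x z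
  have s0 : 0 ≤ s := Finset.sum_nonneg fun x _ => r0 x
  -- This is `log u ≥ 1 - 1/u` at `u = t s / (r c)`, times `t`. Summed over `x, z`, the left side
  -- vanishes: nonnegativity of relative entropy.
  have key : ∀ x z, t x z - r x * c z / s ≤
      t x z * (Real.log (t x z) + Real.log s - Real.log (r x) - Real.log (c z)) := by
    intro x z
    rcases (ht x z).eq_or_lt with h | h
    · rw [← h]
      have := div_nonneg (mul_nonneg (r0 x) (c0 z)) s0
      linarith
    · have hr1 : 0 < r x :=
        h.trans_le (Finset.single_le_sum (f := fun z => t x z) (fun z _ => ht x z)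
          (Finset.mem_univ z))
      have hc1 : 0 < c z :=
        h.trans_le (Finset.single_le_sum (f := fun x => t x z) (fun x _ => ht x z)
          (Finset.mem_univ x))
      have hs1 : 0 < s :=
        hr1.trans_le (Finset.single_le_sum (f := r) (fun x _ => r0 x) (Finset.mem_univ x))
      have h1 := Real.one_sub_inv_le_log_of_pos (x := t x z * s / (r x * c z)) (by positivity)
      rw [Real.log_div (by positivity) (by positivity), Real.log_mul h.ne' hs1.ne',
        Real.log_mul hr1.ne' hc1.ne'] at h1
      have h2 := mul_le_mul_of_nonneg_left h1 h.le
      have h3 : t x z * (1 - (t x z * s / (r x * c z))⁻¹) = t x z - r x * c z / s := by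
        field_simp
      rw [h3] at h2
      linarith
  have hsum := Finset.sum_le_sum fun x (_ : x ∈ Finset.univ) =>
    Finset.sum_le_sum fun z (_ : z ∈ Finset.univ) => key x z
  have hl : ∑ x, ∑ z, (t x z - r x * c z / s) = 0 := by
    simp only [Finset.sum_sub_distrib, mul_div_assoc, ← Finset.mul_sum, ← Finset.sum_div,
      ← Finset.sum_mul, hrs, hcs]
    rw [← hs]
    rcases eq_or_ne s 0 with h | h
    · simp [h]
    · field_simp; ring
  have hR : ∑ x, ∑ z, t x z * (Real.log (t x z) + Real.log s - Real.log (r x) - Real.log (c z))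
      = ∑ x, Real.negMulLog (r x) + ∑ z, Real.negMulLog (c z)
        - ∑ x, ∑ z, Real.negMulLog (t x z) - Real.negMulLog s := by
    have e1 : ∑ x, ∑ z, t x z * Real.log (r x) = - ∑ x, Real.negMulLog (r x) := by
      simp only [← Finset.sum_mul, Real.negMulLog, neg_mul, Finset.sum_neg_distrib, neg_neg]
      rfl
    have e2 : ∑ x, ∑ z, t x z * Real.log (c z) = - ∑ z, Real.negMulLog (c z) := by
      rw [Finset.sum_comm]
      simp only [← Finset.sum_mul, Real.negMulLog, neg_mul, Finset.sum_neg_distrib, neg_neg]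
      rfl
    have e3 : ∑ x, ∑ z, t x z * Real.log s = - Real.negMulLog s := by
      simp only [← Finset.sum_mul, Real.negMulLog, neg_mul, neg_neg]
      rfl
    have e4 : ∑ x, ∑ z, t x z * Real.log (t x z) = - ∑ x, ∑ z, Real.negMulLog (t x z) := by
      simp only [Real.negMulLog, neg_mul, Finset.sum_neg_distrib, neg_neg]
    simp only [mul_sub, mul_add, Finset.sum_sub_distrib, Finset.sum_add_distrib, e1, e2, e3, e4]
    ring
  rw [hl, hR] at hsum
  linarith

/-- Conditioning on more does not increase the entropy. -/
theorem condShannon_prod_le [Fintype α] [Fintype β] [Fintype γ] {p : Ω → ℝ} (hp : ∀ ω, 0 ≤ p ω)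
    (f : Ω → α) (g : Ω → β) (l : Ω → γ) :
    condShannon p f (fun ω => (g ω, l ω)) ≤ condShannon p f g := by
  classical
  set t : α → β → γ → ℝ := fun x y z => push p (fun ω => (f ω, g ω, l ω)) (x, y, z) with ht
  have ht0 : ∀ x y z, 0 ≤ t x y z := fun x y z => push_nonneg hp _ _
  have h1 : ∀ y z, push p (fun ω => (g ω, l ω)) (y, z) = ∑ x, t x y z := by
    intro y z
    rw [show (fun ω => (g ω, l ω)) = fun ω => Prod.snd (f ω, g ω, l ω) from rfl,
      ← push_push p (fun ω => (f ω, g ω, l ω)) Prod.snd, push_snd_eq]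
  have h2 : ∀ x y, push p (fun ω => (f ω, g ω)) (x, y) = ∑ z, t x y z := by
    intro x y
    simp only [ht, push, Prod.mk.injEq]
    rw [Finset.sum_comm]
    refine Finset.sum_congr rfl fun ω _ => ?_
    by_cases hx : f ω = x <;> by_cases hy : g ω = y <;> simp [hx, hy]
  have h3 : ∀ y, push p g y = ∑ x, ∑ z, t x y z := by
    intro y
    simp only [← h2]
    rw [show g = fun ω => Prod.snd (f ω, g ω) from rfl,
      ← push_push p (fun ω => (f ω, g ω)) Prod.snd, push_snd_eq]
  -- Subadditivity is applied to each slice `g = y` without normalizing, so slices of mass zero need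
  -- no separate treatment.
  have hy := Finset.sum_le_sum fun y (_ : y ∈ Finset.univ) =>
    sum_negMulLog_add_le (fun x z => t x y z) (fun x z => ht0 x y z)
  unfold condShannon
  simp only [shannon_eq_sum, Fintype.sum_prod_type, h1, h2, h3]
  simp only [Finset.sum_add_distrib] at hy
  rw [Finset.sum_comm (s := (Finset.univ : Finset β)) (t := (Finset.univ : Finset α)),
    Finset.sum_comm (s := (Finset.univ : Finset β)) (t := (Finset.univ : Finset α))] at hy
  have : ∑ x, ∑ y, ∑ z, Real.negMulLog (push p (fun ω => (f ω, g ω, l ω)) (x, y, z)) =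
    ∑ x, ∑ y, ∑ z, Real.negMulLog (t x y z) := rfl
  rw [this]
  linarith

theorem sqMass_nonneg {Ω : Type*} {p : Ω → ℝ} (hp : ∀ ω, 0 ≤ p ω) (x : Ω × Ω) : 0 ≤ sqMass p x :=
  mul_nonneg (hp _) (hp _)

theorem sum_sqMass (p : Ω → ℝ) : ∑ x, sqMass p x = (∑ ω, p ω) ^ 2 := by
  simp only [sqMass, Fintype.sum_prod_type, ← Finset.mul_sum, ← Finset.sum_mul, sq]

theorem push_sqMass (p : Ω → ℝ) (f : Ω → α) :
    push (sqMass p) (fun x => (f x.1, f x.2)) = sqMass (push p f) := by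
  classical
  funext ⟨a, b⟩
  simp only [push, sqMass, Fintype.sum_prod_type, Prod.mk.injEq, Finset.sum_mul_sum]
  refine Finset.sum_congr rfl fun x _ => Finset.sum_congr rfl fun y _ => ?_
  by_cases h1 : f x = a <;> by_cases h2 : f y = b <;> simp [h1, h2]

theorem shannon_sqMass [Fintype α] {p : Ω → ℝ} (h1 : ∑ ω, p ω = 1) (f : Ω → α) :
    shannon (sqMass p) (fun x => (f x.1, f x.2)) = 2 * shannon p f := by
  have h := sum_push p f
  rw [shannon_eq_sum, shannon_eq_sum, push_sqMass]
  simp only [sqMass, Fintype.sum_prod_type, Real.negMulLog_mul, Finset.sum_add_distrib,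
    ← Finset.sum_mul, ← Finset.mul_sum, h, h1]
  ring

end Shannon

end MatrixPolar

namespace MatrixPolar

/-! ### Entropy of convolutions on a finite abelian group. -/

section Convolution

variable {B : Type*} [AddCommGroup B] [Fintype B]

/-- The entropy, in nats, of a mass function. -/
noncomputable def massEnt {B : Type*} [Fintype B] (q : B → ℝ) : ℝ := ∑ x, Real.negMulLog (q x)

/-- The convolution of two mass functions. -/
noncomputable def massConv (q q' : B → ℝ) (x : B) : ℝ := ∑ y, q' y * q (x - y)

/-- The increase of the entropy under convolution. -/
noncomputable def convGap (q q' : B → ℝ) : ℝ :=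
  massEnt (massConv q q') - (massEnt q + massEnt q') / 2

theorem massConv_comm (q q' : B → ℝ) : massConv q q' = massConv q' q := by
  funext x
  unfold massConv
  rw [← (Equiv.subLeft x).sum_comp]
  simp [mul_comm]

theorem sum_massEnt_translate (q q' : B → ℝ) (h1 : ∑ y, q' y = 1) :
    ∑ x, ∑ y, q' y * Real.negMulLog (q (x - y)) = massEnt q := by
  rw [Finset.sum_comm]
  have : ∀ y : B, ∑ x, q' y * Real.negMulLog (q (x - y)) = q' y * massEnt q := by
    intro y
    rw [← Finset.mul_sum]
    exact congrArg _ ((Equiv.subRight y).sum_comp fun x => Real.negMulLog (q x))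
  simp only [this, ← Finset.sum_mul, h1, one_mul]

/-- Jensen's inequality: a convolution is a `q'`-weighted average of translates of `q`. -/
theorem le_negMulLog_massConv {q q' : B → ℝ} (hq : ∀ x, 0 ≤ q x) (hq' : q' ∈ stdSimplex ℝ B)
    (x : B) :
    ∑ y, q' y * Real.negMulLog (q (x - y)) ≤ Real.negMulLog (massConv q q' x) :=
  Real.concaveOn_negMulLog.le_map_sum (t := Finset.univ) (w := q') (p := fun y => q (x - y))
    (fun y _ => hq'.1 y) hq'.2 (fun _ _ => hq _)

theorem massEnt_le_massConv {q q' : B → ℝ} (hq : ∀ x, 0 ≤ q x) (hq' : q' ∈ stdSimplex ℝ B) :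
    massEnt q ≤ massEnt (massConv q q') := by
  rw [← sum_massEnt_translate q q' hq'.2]
  exact Finset.sum_le_sum fun x _ => le_negMulLog_massConv hq hq' x

/-- Equal sums force equality in Jensen at every `x`; strict concavity then makes all values of
positive weight agree. -/
theorem translate_eq_of_massEnt_eq {q q' : B → ℝ} (hq : ∀ x, 0 ≤ q x)
    (hq' : q' ∈ stdSimplex ℝ B) (h : massEnt (massConv q q') = massEnt q) {y y' : B}
    (hy : q' y ≠ 0) (hy' : q' y' ≠ 0) (x : B) : q (x - y) = q (x - y') := by
  rw [← sum_massEnt_translate q q' hq'.2] at h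
  have h2 := (Finset.sum_eq_sum_iff_of_le fun x _ => le_negMulLog_massConv hq hq' x).1 h.symm x
    (Finset.mem_univ x)
  have h3 := (Real.strictConcaveOn_negMulLog.map_sum_eq_iff' (t := Finset.univ) (w := q')
    (p := fun y => q (x - y)) (fun y _ => hq'.1 y) hq'.2 (fun _ _ => hq _)).1 h2.symm
  exact (h3 y (Finset.mem_univ _) hy).trans (h3 y' (Finset.mem_univ _) hy').symm

theorem convGap_nonneg {q q' : B → ℝ} (hq : q ∈ stdSimplex ℝ B) (hq' : q' ∈ stdSimplex ℝ B) :
    0 ≤ convGap q q' := by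
  have h1 := massEnt_le_massConv hq.1 hq'
  have h2 := massEnt_le_massConv hq'.1 hq
  rw [massConv_comm] at h2
  unfold convGap
  linarith

theorem massEnt_eq_of_convGap_eq_zero {q q' : B → ℝ} (hq : q ∈ stdSimplex ℝ B)
    (hq' : q' ∈ stdSimplex ℝ B) (h : convGap q q' = 0) :
    massEnt (massConv q q') = massEnt q ∧ massEnt (massConv q' q) = massEnt q' := by
  have h1 := massEnt_le_massConv hq.1 hq'
  have h2 := massEnt_le_massConv hq'.1 hq
  rw [massConv_comm q' q] at h2 ⊢
  unfold convGap at h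
  constructor <;> linarith

/-- The subgroup of the periods of a function. -/
def periods (q : B → ℝ) : AddSubgroup B where
  carrier := {a | ∀ x, q (x + a) = q x}
  zero_mem' := by simp
  add_mem' := by
    intro a b ha hb x
    rw [← add_assoc, hb, ha]
  neg_mem' := by
    intro a ha x
    have := ha (x + -a)
    simpa using this.symm

-- The support of `q` contains a translate of the periods of `q`, and by `h` the differences of its
-- points are periods of `q'`.
open scoped Classical in
theorem card_periods_le {q q' : B → ℝ} {y : B} (hy : q y ≠ 0)
    (h : ∀ a b, q a ≠ 0 → q b ≠ 0 → ∀ x, q' (x - a) = q' (x - b)) :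
    Nat.card (periods q) ≤ (Finset.univ.filter fun x => q x ≠ 0).card ∧
      (Finset.univ.filter fun x => q x ≠ 0).card ≤ Nat.card (periods q') := by
  constructor
  · rw [Nat.card_eq_fintype_card, ← Finset.card_univ]
    refine Finset.card_le_card_of_injOn (fun a => y + a.1) ?_ ?_
    · intro a _
      simp only [Finset.coe_filter, Finset.mem_univ, true_and, Set.mem_ofPred_eq]
      rw [a.2 y]
      exact hy
    · intro a _ b _ hab
      exact Subtype.ext (add_left_cancel hab)
  · have hmem : ∀ x, q x ≠ 0 → y - x ∈ periods q' := by
      intro x hx z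
      have := h x y hx hy (z + y)
      rw [add_sub_cancel_right] at this
      rw [← this]
      congr 1
      abel
    rw [Nat.card_eq_fintype_card, ← Fintype.card_coe]
    refine Fintype.card_le_of_injective (fun x => ⟨y - x.1, hmem x.1 (Finset.mem_filter.1 x.2).2⟩) ?_
    intro a b hab
    have := congrArg Subtype.val hab
    exact Subtype.ext (sub_right_injective this)

theorem exists_massEnt_eq_log_card {q q' : B → ℝ} (hq : q ∈ stdSimplex ℝ B)
    (hq' : q' ∈ stdSimplex ℝ B) (h : convGap q q' = 0) :
    ∃ K : AddSubgroup B, massEnt q = Real.log (Nat.card K) := by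
  classical
  obtain ⟨e1, e2⟩ := massEnt_eq_of_convGap_eq_zero hq hq' h
  have ex : ∀ u ∈ stdSimplex ℝ B, ∃ y, u y ≠ 0 := by
    intro u hu
    by_contra! hc
    have := hu.2
    simp [hc] at this
  obtain ⟨y, hy⟩ := ex q hq
  obtain ⟨y', hy'⟩ := ex q' hq'
  have a1 := card_periods_le hy
    (fun a b ha hb => translate_eq_of_massEnt_eq hq'.1 hq e2 ha hb)
  have a2 := card_periods_le hy'
    (fun a b ha hb => translate_eq_of_massEnt_eq hq.1 hq' e1 ha hb)
  refine ⟨periods q, ?_⟩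
  set s := Finset.univ.filter fun x => q x ≠ 0 with hs
  -- `a1` and `a2` close a cycle of inequalities through both supports and both period groups, so
  -- all four cardinalities agree. Thus `q` is uniform on a coset of its periods.
  have hcard : s.card = Nat.card (periods q) := by omega
  have himg : (Finset.univ.image fun a : periods q => y + a.1) = s := by
    apply Finset.eq_of_subset_of_card_le
    · intro x hx
      obtain ⟨a, _, rfl⟩ := Finset.mem_image.1 hx
      simp only [hs, Finset.mem_filter, Finset.mem_univ, true_and]
      rw [a.2 y]
      exact hy
    · rw [Finset.card_image_of_injective _ fun a b hab => Subtype.ext (add_left_cancel hab),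
        hcard, Nat.card_eq_fintype_card, Finset.card_univ]
  have hval : ∀ x ∈ s, q x = q y := by
    intro x hx
    rw [← himg] at hx
    obtain ⟨a, _, rfl⟩ := Finset.mem_image.1 hx
    exact a.2 y
  have hsum : (s.card : ℝ) * q y = 1 := by
    rw [← hq.2, ← Finset.sum_filter_ne_zero, ← hs, Finset.sum_congr rfl hval]
    simp
  have hent : massEnt q = s.card * Real.negMulLog (q y) := by
    unfold massEnt
    rw [← Finset.sum_subset (Finset.subset_univ s),
      Finset.sum_congr rfl (fun x hx => by rw [hval x hx])]
    · simp
    · intro x _ hx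
      have : q x = 0 := by simpa [hs] using hx
      simp [this]
  have hqy : q y = (s.card : ℝ)⁻¹ := eq_inv_of_mul_eq_one_right hsum
  rw [hent, Real.negMulLog, ← hcard]
  rw [show (s.card : ℝ) * (-q y * Real.log (q y)) = -(s.card * q y) * Real.log (q y) by ring,
    hsum, hqy, Real.log_inv]
  ring

theorem continuous_massEnt {B : Type*} [Fintype B] : Continuous (massEnt : (B → ℝ) → ℝ) := by
  unfold massEnt
  exact continuous_finsetSum _ fun x _ => Real.continuous_negMulLog.comp (continuous_apply x)

theorem continuous_convGap :
    Continuous fun x : (B → ℝ) × (B → ℝ) => convGap x.1 x.2 := by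
  unfold convGap
  refine ((continuous_massEnt.comp ?_).sub
    (((continuous_massEnt.comp continuous_fst).add
      (continuous_massEnt.comp continuous_snd)).div_const 2))
  unfold massConv
  fun_prop

end Convolution

/-- On the compact part of `K` where `ε ≤ g`, `f` has a positive minimum; `C` is an upper bound of
`g` divided by it. -/
theorem exists_le_add_mul_of_isCompact {X : Type*} [TopologicalSpace X] {K : Set X}
    (hK : IsCompact K) {f g : X → ℝ} (hf : Continuous f) (hg : Continuous g)
    (hf0 : ∀ x ∈ K, 0 ≤ f x) (hfg : ∀ x ∈ K, f x = 0 → g x = 0) {ε : ℝ} (hε : 0 < ε) :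
    ∃ C : ℝ, 0 < C ∧ ∀ x ∈ K, g x ≤ ε + C * f x := by
  obtain ⟨M, hM⟩ := (hK.image hg).bddAbove
  rcases (K ∩ {x | ε ≤ g x}).eq_empty_or_nonempty with he | hne
  · refine ⟨1, one_pos, fun x hx => ?_⟩
    have h1 : g x < ε := by
      by_contra! hc
      exact (he ▸ (⟨hx, hc⟩ : x ∈ K ∩ {x | ε ≤ g x}) : x ∈ (∅ : Set X))
    linarith [hf0 x hx]
  · obtain ⟨z, hz, hmin⟩ := (hK.inter_right (isClosed_le continuous_const hg)).exists_isMinOn hne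
      hf.continuousOn
    have hz0 : 0 < f z := by
      refine (hf0 z hz.1).lt_of_ne fun h => ?_
      have h1 := hfg z hz.1 h.symm
      have h2 : ε ≤ g z := hz.2
      linarith
    have hM0 : 0 < M := (hε.trans_le hz.2).trans_le (hM ⟨z, hz.1, rfl⟩)
    refine ⟨M / f z, by positivity, fun x hx => ?_⟩
    have hx0 := mul_nonneg (div_pos hM0 hz0).le (hf0 x hx)
    by_cases hc : ε ≤ g x
    · have h1 : f z ≤ f x := hmin ⟨hx, hc⟩
      have h2 : M ≤ M / f z * f x := by
        rw [div_mul_eq_mul_div, le_div_iff₀ hz0]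
        exact mul_le_mul_of_nonneg_left h1 hM0.le
      linarith [hM ⟨x, hx, rfl⟩]
    · linarith

/-- The possible entropies, in nats, of uniform distributions on subgroups of `𝔽₂ ^ r`. -/
noncomputable def logLevels (r : ℕ) : Set ℝ := (fun t : ℕ => t * Real.log 2) '' Set.Iic r

/-- The term `|massEnt q - massEnt q'|` is needed for mixtures: conditional laws must be near the
same level, since an average of different levels need not be a level. -/
theorem exists_infDist_massEnt_le {B : Type*} [AddCommGroup B] [Fintype B] {r : ℕ}
    (hB : Nat.card B = 2 ^ r) {ε : ℝ} (hε : 0 < ε) :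
    ∃ C : ℝ, 0 < C ∧ ∀ q ∈ stdSimplex ℝ B, ∀ q' ∈ stdSimplex ℝ B,
      Metric.infDist (massEnt q) (logLevels r) + |massEnt q - massEnt q'| ≤
        ε + C * convGap q q' := by
  suffices H : ∃ C : ℝ, 0 < C ∧ ∀ x ∈ stdSimplex ℝ B ×ˢ stdSimplex ℝ B,
      Metric.infDist (massEnt x.1) (logLevels r) + |massEnt x.1 - massEnt x.2| ≤
        ε + C * convGap x.1 x.2 by
    obtain ⟨C, hC, h⟩ := H
    exact ⟨C, hC, fun q hq q' hq' => h (q, q') ⟨hq, hq'⟩⟩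
  refine exists_le_add_mul_of_isCompact
    ((isCompact_stdSimplex ℝ B).prod (isCompact_stdSimplex ℝ B)) continuous_convGap ?_ ?_ ?_ hε
  · refine ((Metric.continuous_infDist_pt _).comp (continuous_massEnt.comp continuous_fst)).add ?_
    exact ((continuous_massEnt.comp continuous_fst).sub
      (continuous_massEnt.comp continuous_snd)).abs
  · exact fun x hx => convGap_nonneg hx.1 hx.2
  · rintro ⟨q, q'⟩ ⟨hq, hq'⟩ h0
    simp only at hq hq' h0 ⊢
    obtain ⟨e1, e2⟩ := massEnt_eq_of_convGap_eq_zero hq hq' h0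
    rw [massConv_comm, e1] at e2
    obtain ⟨K, hKq⟩ := exists_massEnt_eq_log_card hq hq' h0
    obtain ⟨t, ht, hKt⟩ := (Nat.dvd_prime_pow Nat.prime_two).1
      (hB ▸ K.card_addSubgroup_dvd_card)
    have hmem : massEnt q ∈ logLevels r := ⟨t, ht, by rw [hKq, hKt]; simp⟩
    rw [Metric.infDist_zero_of_mem hmem, e2, sub_self, abs_zero, add_zero]

end MatrixPolar

namespace MatrixPolar

/-! ### Conditional entropies as averages over the side information. -/

section Mixture

variable {V B : Type*} [Fintype V] [Fintype B]

/-- The joint mass function with marginal `P` and conditional mass functions `Q v`. -/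
def mixMass (P : V → ℝ) (Q : V → B → ℝ) (x : V × B) : ℝ := P x.1 * Q x.1 x.2

theorem exists_eq_mixMass [Nonempty B] {q : V × B → ℝ} (hq : q ∈ stdSimplex ℝ (V × B)) :
    ∃ P ∈ stdSimplex ℝ V, ∃ Q : V → B → ℝ, (∀ v, Q v ∈ stdSimplex ℝ B) ∧ q = mixMass P Q := by
  classical
  have hP0 : ∀ v, 0 ≤ ∑ b, q (v, b) := fun v => Finset.sum_nonneg fun b _ => hq.1 _
  have h : ∀ v, ∃ u ∈ stdSimplex ℝ B, ∀ b, q (v, b) = (∑ b, q (v, b)) * u b := by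
    intro v
    rcases eq_or_ne (∑ b, q (v, b)) 0 with h0 | h0
    -- Where `v` has mass zero the conditional law is arbitrary; a point mass serves.
    · refine ⟨Pi.single (Classical.arbitrary B) 1, single_mem_stdSimplex _ _, fun b => ?_⟩
      rw [h0, zero_mul]
      exact (Finset.sum_eq_zero_iff_of_nonneg fun b _ => hq.1 (v, b)).1 h0 b (Finset.mem_univ b)
    · refine ⟨fun b => q (v, b) / ∑ b, q (v, b),
        ⟨fun b => div_nonneg (hq.1 _) (hP0 v), ?_⟩, fun b => ?_⟩
      · rw [← Finset.sum_div, div_self h0]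
      · field_simp
  choose Q hQ hQe using h
  refine ⟨fun v => ∑ b, q (v, b), ⟨hP0, ?_⟩, Q, hQ, ?_⟩
  · rw [← Fintype.sum_prod_type]
    exact hq.2
  · funext ⟨v, b⟩
    exact hQe v b

theorem condShannon_mixMass (P : V → ℝ) {Q : V → B → ℝ} (hQ : ∀ v, Q v ∈ stdSimplex ℝ B) :
    condShannon (mixMass P Q) Prod.snd Prod.fst = ∑ v, P v * massEnt (Q v) := by
  have h1 : shannon (mixMass P Q) Prod.fst = ∑ v, Real.negMulLog (P v) := by
    rw [shannon_eq_sum]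
    refine Finset.sum_congr rfl fun v _ => ?_
    rw [push_fst_eq]
    simp only [mixMass, ← Finset.mul_sum, (hQ v).2, mul_one]
  unfold condShannon
  rw [shannon_congr _ (g := fun x => x), shannon_eq_sum, push_id, h1, Fintype.sum_prod_type]
  · simp only [mixMass, Real.negMulLog_mul, Finset.sum_add_distrib, ← Finset.sum_mul,
      ← Finset.mul_sum, (hQ _).2, one_mul, massEnt]
    ring
  · rintro ⟨v, b⟩ ⟨v', b'⟩
    simp only [Prod.mk.injEq]
    tauto

theorem massConv_mem {B : Type*} [AddCommGroup B] [Fintype B] {q q' : B → ℝ}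
    (hq : q ∈ stdSimplex ℝ B) (hq' : q' ∈ stdSimplex ℝ B) :
    massConv q q' ∈ stdSimplex ℝ B := by
  refine ⟨fun x => Finset.sum_nonneg fun y _ => mul_nonneg (hq'.1 _) (hq.1 _), ?_⟩
  unfold massConv
  rw [Finset.sum_comm]
  have : ∀ y : B, ∑ x, q' y * q (x - y) = q' y := by
    intro y
    have h : ∑ x, q (x - y) = ∑ x, q x := (Equiv.subRight y).sum_comp q
    rw [← Finset.mul_sum, h, hq.2, mul_one]
  simp only [this, hq'.2]

theorem push_sqMass_mixMass [AddCommGroup B] (P : V → ℝ) (Q : V → B → ℝ) :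
    push (sqMass (mixMass P Q))
        (fun x : (V × B) × (V × B) => ((x.1.1, x.2.1), x.1.2 + x.2.2)) =
      mixMass (sqMass P) (fun v => massConv (Q v.1) (Q v.2)) := by
  classical
  funext ⟨⟨v, v'⟩, a⟩
  simp only [push, sqMass, mixMass, massConv, Fintype.sum_prod_type, Prod.mk.injEq]
  rw [Finset.sum_eq_single v (by intro w _ hw; simp [hw]) (by simp)]
  rw [Finset.sum_comm, Finset.sum_eq_single v' (by intro w _ hw; simp [hw]) (by simp)]
  rw [Finset.sum_comm, Finset.mul_sum]
  refine Finset.sum_congr rfl fun y _ => ?_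
  rw [Finset.sum_eq_single (a - y)]
  · simp only [sub_add_cancel, and_self, if_true]
    ring
  · intro b _ hb
    rw [if_neg]
    rintro ⟨-, h⟩
    exact hb (eq_sub_of_add_eq h)
  · simp

theorem sqMass_mem {P : V → ℝ} (hP : P ∈ stdSimplex ℝ V) : sqMass P ∈ stdSimplex ℝ (V × V) :=
  ⟨sqMass_nonneg hP.1, by rw [sum_sqMass, hP.2, one_pow]⟩

theorem push_mem {Ω : Type*} [Fintype Ω] {p : Ω → ℝ} (hp : p ∈ stdSimplex ℝ Ω) (f : Ω → V) :
    push p f ∈ stdSimplex ℝ V :=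
  ⟨push_nonneg hp.1 f, by rw [sum_push, hp.2]⟩

theorem massEnt_nonneg {q : B → ℝ} (hq : q ∈ stdSimplex ℝ B) : 0 ≤ massEnt q :=
  Finset.sum_nonneg fun x _ => Real.negMulLog_nonneg (hq.1 x)
    (hq.2 ▸ Finset.single_le_sum (fun y _ => hq.1 y) (Finset.mem_univ x))

/-- Crude, but the convergence argument needs only a bound uniform over all sources. -/
theorem massEnt_le_card {q : B → ℝ} (hq : q ∈ stdSimplex ℝ B) :
    massEnt q ≤ Fintype.card B := by
  have h : ∀ x, Real.negMulLog (q x) ≤ 1 := by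
    intro x
    rcases (hq.1 x).eq_or_lt with h | h
    · simp [← h]
    · have h1 := mul_le_mul_of_nonneg_left (Real.one_sub_inv_le_log_of_pos h) h.le
      rw [mul_sub, mul_inv_cancel₀ h.ne'] at h1
      unfold Real.negMulLog
      linarith
  calc massEnt q ≤ ∑ _x : B, (1 : ℝ) := Finset.sum_le_sum fun x _ => h x
    _ = Fintype.card B := by simp

theorem condShannon_fst_mem {q : V × B → ℝ} (hq : q ∈ stdSimplex ℝ (V × B)) :
    condShannon q Prod.snd Prod.fst ∈ Set.Icc (0 : ℝ) (Fintype.card B) := by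
  have : Nonempty B := by
    by_contra hB
    rw [not_nonempty_iff] at hB
    have := hq.2
    simp at this
  obtain ⟨P, hP, Q, hQ, rfl⟩ := exists_eq_mixMass hq
  rw [condShannon_mixMass P hQ]
  constructor
  · exact Finset.sum_nonneg fun v _ => mul_nonneg (hP.1 v) (massEnt_nonneg (hQ v))
  · calc ∑ v, P v * massEnt (Q v) ≤ ∑ v, P v * (Fintype.card B : ℝ) :=
          Finset.sum_le_sum fun v _ => mul_le_mul_of_nonneg_left (massEnt_le_card (hQ v)) (hP.1 v)
      _ = Fintype.card B := by rw [← Finset.sum_mul, hP.2, one_mul]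

variable [AddCommGroup B]

/-- The increase of the conditional entropy when two independent copies are added. -/
noncomputable def condGap (q : V × B → ℝ) : ℝ :=
  condShannon (sqMass q) (fun x => x.1.2 + x.2.2) (fun x => (x.1.1, x.2.1)) -
    condShannon q Prod.snd Prod.fst

/-- The symmetric half-sum in `convGap` makes this an identity: both entropy terms have the same
average when `v, v'` are independent. -/
theorem condGap_mixMass {P : V → ℝ} (hP : P ∈ stdSimplex ℝ V) {Q : V → B → ℝ}
    (hQ : ∀ v, Q v ∈ stdSimplex ℝ B) :
    condGap (mixMass P Q) = ∑ v, ∑ v', P v * P v' * convGap (Q v) (Q v') := by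
  have h := condShannon_push (sqMass (mixMass P Q))
    (fun x : (V × B) × (V × B) => ((x.1.1, x.2.1), x.1.2 + x.2.2)) Prod.snd Prod.fst
  rw [push_sqMass_mixMass, condShannon_mixMass _ (Q := fun v : V × V => massConv (Q v.1) (Q v.2))
    fun v => massConv_mem (hQ v.1) (hQ v.2)] at h
  simp only at h
  unfold condGap
  rw [← h, condShannon_mixMass P hQ, Fintype.sum_prod_type]
  have e1 : ∑ v, ∑ v', P v * P v' * massEnt (Q v) = ∑ v, P v * massEnt (Q v) := by
    refine Finset.sum_congr rfl fun v _ => ?_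
    rw [← Finset.sum_mul, ← Finset.mul_sum, hP.2, mul_one]
  have e2 : ∑ v, ∑ v', P v * P v' * massEnt (Q v') = ∑ v, P v * massEnt (Q v) := by
    simp only [mul_assoc, ← Finset.mul_sum, ← Finset.sum_mul, hP.2, one_mul]
  simp only [convGap, sqMass, mul_sub, mul_div_assoc', mul_add, Finset.sum_sub_distrib,
    ← Finset.sum_div, Finset.sum_add_distrib, e1, e2]
  ring

theorem condGap_nonneg {q : V × B → ℝ} (hq : q ∈ stdSimplex ℝ (V × B)) : 0 ≤ condGap q := by
  obtain ⟨P, hP, Q, hQ, rfl⟩ := exists_eq_mixMass hq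
  rw [condGap_mixMass hP hQ]
  exact Finset.sum_nonneg fun v _ => Finset.sum_nonneg fun v' _ =>
    mul_nonneg (mul_nonneg (hP.1 v) (hP.1 v')) (convGap_nonneg (hQ v) (hQ v'))

end Mixture

/-- If adding two independent copies hardly increases the conditional entropy, then this entropy is
close to the entropy of the uniform distribution on a subgroup. -/
theorem exists_infDist_condShannon_le {B : Type*} [AddCommGroup B] [Fintype B] {r : ℕ}
    (hB : Nat.card B = 2 ^ r) {ε : ℝ} (hε : 0 < ε) :
    ∃ C : ℝ, 0 < C ∧ ∀ {V : Type} [Fintype V] (q : V × B → ℝ), q ∈ stdSimplex ℝ (V × B) →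
      Metric.infDist (condShannon q Prod.snd Prod.fst) (logLevels r) ≤ ε + C * condGap q := by
  obtain ⟨C, hC, hst⟩ := exists_infDist_massEnt_le hB hε
  refine ⟨C, hC, fun {V} _ q hq => ?_⟩
  obtain ⟨P, hP, Q, hQ, rfl⟩ := exists_eq_mixMass hq
  rw [condGap_mixMass hP hQ, condShannon_mixMass P hQ]
  set H := ∑ v, P v * massEnt (Q v) with hH
  have hPP : ∑ v, ∑ v', P v * P v' = 1 := by
    simp only [← Finset.mul_sum, ← Finset.sum_mul, hP.2, one_mul]
  have hdiff : ∀ v, massEnt (Q v) - H = ∑ v', P v' * (massEnt (Q v) - massEnt (Q v')) := by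
    intro v
    simp only [mul_sub, Finset.sum_sub_distrib, ← Finset.sum_mul, hP.2, one_mul, hH]
  have habs : ∀ v, |massEnt (Q v) - H| ≤ ∑ v', P v' * |massEnt (Q v) - massEnt (Q v')| := by
    intro v
    rw [hdiff v]
    refine (Finset.abs_sum_le_sum_abs _ _).trans (Finset.sum_le_sum fun v' _ => ?_)
    rw [abs_mul, abs_of_nonneg (hP.1 v')]
  -- The distance to the levels is 1-Lipschitz, and `H` differs from `massEnt (Q v)` by at most the
  -- mean deviation in `habs`.
  have hv : ∀ v, Metric.infDist H (logLevels r) ≤ ∑ v', P v' *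
      (Metric.infDist (massEnt (Q v)) (logLevels r) + |massEnt (Q v) - massEnt (Q v')|) := by
    intro v
    have h1 := Metric.infDist_le_infDist_add_dist (s := logLevels r) (x := H) (y := massEnt (Q v))
    rw [dist_comm, Real.dist_eq] at h1
    simp only [mul_add, Finset.sum_add_distrib, ← Finset.sum_mul, hP.2, one_mul]
    linarith [habs v]
  calc Metric.infDist H (logLevels r)
      = ∑ v, P v * Metric.infDist H (logLevels r) := by rw [← Finset.sum_mul, hP.2, one_mul]
    _ ≤ ∑ v, P v * ∑ v', P v' *
          (Metric.infDist (massEnt (Q v)) (logLevels r) + |massEnt (Q v) - massEnt (Q v')|) :=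
        Finset.sum_le_sum fun v _ => mul_le_mul_of_nonneg_left (hv v) (hP.1 v)
    _ ≤ ∑ v, P v * ∑ v', P v' * (ε + C * convGap (Q v) (Q v')) :=
        Finset.sum_le_sum fun v _ => mul_le_mul_of_nonneg_left
          (Finset.sum_le_sum fun v' _ => mul_le_mul_of_nonneg_left
            (hst _ (hQ v) _ (hQ v')) (hP.1 v')) (hP.1 v)
    _ = ε * (∑ v, ∑ v', P v * P v') + C * ∑ v, ∑ v', P v * P v' * convGap (Q v) (Q v') := by
        simp only [Finset.mul_sum, ← Finset.sum_add_distrib]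
        exact Finset.sum_congr rfl fun v _ => Finset.sum_congr rfl fun v' _ => by ring
    _ = ε + C * ∑ v, ∑ v', P v * P v' * convGap (Q v) (Q v') := by rw [hPP, mul_one]

/-! ### Sources and a single polarization step. -/

/-- A random element of `A` with side information in a finite type. -/
structure Source (A : Type) [Fintype A] where
  /-- The alphabet of the side information. -/
  V : Type
  /-- The alphabet of the side information is finite. -/
  [fintypeV : Fintype V]
  /-- The joint mass function of the side information and the element of `A`. -/
  p : V × A → ℝ
  mem : p ∈ stdSimplex ℝ (V × A)

attribute [instance] Source.fintypeV

namespace Source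

section Steps

variable {A : Type} [AddCommGroup A] [Fintype A]

/-- The data that the first output of a polarization step depends on. -/
def minusMap {V A : Type} [Add A] (x : (V × A) × (V × A)) : (V × V) × A :=
  ((x.1.1, x.2.1), x.1.2 + x.2.2)

/-- The data that the second output of a polarization step depends on. -/
def plusMap {V A : Type} [Add A] (x : (V × A) × (V × A)) : ((V × V) × A) × A :=
  (minusMap x, x.2.2)

/-- The source `U₁ + U₂` with side information `V₁, V₂`. -/
noncomputable def minus (W : Source A) : Source A where
  V := W.V × W.V
  p := push (sqMass W.p) minusMap
  mem := push_mem (sqMass_mem W.mem) _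

/-- The source `U₂` with side information `V₁, V₂, U₁ + U₂`. -/
noncomputable def plus (W : Source A) : Source A where
  V := (W.V × W.V) × A
  p := push (sqMass W.p) plusMap
  mem := push_mem (sqMass_mem W.mem) _

variable {B : Type} [AddCommGroup B] [Fintype B] (π : A →+ B)

/-- The entropy, in nats, of `π U` given the side information. -/
noncomputable def ent (W : Source A) : ℝ := condShannon W.p (fun x => π x.2) Prod.fst

/-- The joint mass function of the side information and `π U`. -/
noncomputable def image (W : Source A) : W.V × B → ℝ := push W.p (fun x => (x.1, π x.2))

theorem image_mem (W : Source A) : W.image π ∈ stdSimplex ℝ (W.V × B) := push_mem W.mem _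

theorem ent_eq_image (W : Source A) :
    W.ent π = condShannon (W.image π) Prod.snd Prod.fst := by
  unfold image
  rw [condShannon_push]
  rfl

theorem ent_mem (W : Source A) : W.ent π ∈ Set.Icc (0 : ℝ) (Fintype.card B) := by
  rw [ent_eq_image]
  exact condShannon_fst_mem (W.image_mem π)

theorem ent_minus {B : Type} [AddCommGroup B] (π : A →+ B) (W : Source A) : W.minus.ent π =
    condShannon (sqMass W.p) (fun x => π x.1.2 + π x.2.2) (fun x => (x.1.1, x.2.1)) := by
  have h : W.minus.ent π = condShannon (push (sqMass W.p) minusMap) (fun x => π x.2) Prod.fst :=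
    rfl
  rw [h, condShannon_push]
  simp only [minusMap, map_add]

theorem condGap_image (W : Source A) : condGap (W.image π) = W.minus.ent π - W.ent π := by
  rw [ent_minus, ent_eq_image]
  unfold condGap image
  rw [← push_sqMass, condShannon_push]

theorem ent_le_minus (W : Source A) : W.ent π ≤ W.minus.ent π := by
  have h := condGap_nonneg (W.image_mem π)
  rw [condGap_image] at h
  linarith

/-- If plus revealed only `π (U₁ + U₂)`, the chain rule would give equality. It reveals all of `U₁ +
U₂`, which can only lower the entropy. -/
theorem ent_minus_add_plus_le (W : Source A) :
    W.minus.ent π + W.plus.ent π ≤ 2 * W.ent π := by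
  have hV : shannon (sqMass W.p) (fun x : (W.V × A) × (W.V × A) => (x.1.1, x.2.1)) =
      2 * shannon W.p Prod.fst := shannon_sqMass W.mem.2 Prod.fst
  have hU := shannon_sqMass W.mem.2 (fun x : W.V × A => (π x.2, x.1))
  have hplus : W.plus.ent π ≤ condShannon (sqMass W.p) (fun x => π x.2.2)
      (fun x => ((x.1.1, x.2.1), π x.1.2 + π x.2.2)) := by
    have h : W.plus.ent π = condShannon (push (sqMass W.p) plusMap) (fun x => π x.2) Prod.fst :=
      rfl
    rw [h, condShannon_push]
    refine le_trans (le_of_eq ?_) (condShannon_prod_le (sqMass_nonneg W.mem.1)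
      (fun x : (W.V × A) × (W.V × A) => π x.2.2)
      (fun x => ((x.1.1, x.2.1), π x.1.2 + π x.2.2)) (fun x => x.1.2 + x.2.2))
    refine condShannon_congr _ (fun _ _ _ => Iff.rfl) fun x y => ?_
    simp only [plusMap, minusMap, Prod.mk.injEq, ← map_add]
    constructor
    · rintro ⟨h1, h2⟩
      exact ⟨⟨h1, by rw [h2]⟩, h2⟩
    · rintro ⟨⟨h1, -⟩, h2⟩
      exact ⟨h1, h2⟩
  rw [ent_minus]
  refine (add_le_add_right hplus _).trans (le_of_eq ?_)
  unfold ent condShannon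
  rw [hV, shannon_congr (sqMass W.p)
      (f := fun x : (W.V × A) × (W.V × A) => (π x.1.2 + π x.2.2, (x.1.1, x.2.1)))
      (g := fun x => ((x.1.1, x.2.1), π x.1.2 + π x.2.2)),
    shannon_congr (sqMass W.p)
      (f := fun x : (W.V × A) × (W.V × A) => (π x.2.2, ((x.1.1, x.2.1), π x.1.2 + π x.2.2)))
      (g := fun x => ((π x.1.2, x.1.1), (π x.2.2, x.2.1))), hU]
  · ring
  · intro x y
    simp only [Prod.mk.injEq]
    constructor
    · rintro ⟨h1, ⟨h2, h3⟩, h4⟩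
      rw [h1] at h4
      exact ⟨⟨add_right_cancel h4, h2⟩, h1, h3⟩
    · rintro ⟨⟨h1, h2⟩, h3, h4⟩
      exact ⟨h3, ⟨h2, h4⟩, by rw [h1, h3]⟩
  · intro x y
    simp only [Prod.mk.injEq]
    tauto

theorem exists_infDist_ent_le {r : ℕ} (hB : Nat.card B = 2 ^ r) {ε : ℝ} (hε : 0 < ε) :
    ∃ C : ℝ, 0 < C ∧ ∀ W : Source A,
      Metric.infDist (W.ent π) (logLevels r) ≤ ε + C * (W.minus.ent π - W.ent π) := by
  obtain ⟨C, hC, h⟩ := exists_infDist_condShannon_le hB hε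
  refine ⟨C, hC, fun W => ?_⟩
  rw [← condGap_image, ent_eq_image]
  exact h _ (W.image_mem π)

end Steps

end Source

end MatrixPolar

/-! ### Recursive structure of the polar transform. -/

namespace MatrixPolar

/-- The numbering of the columns of the Kronecker product in `polarMatrix (k + 1)`. -/
def splitEquiv (k : ℕ) : Fin 2 × Fin (2 ^ k) ≃ Fin (2 ^ (k + 1)) :=
  finProdFinEquiv.trans (finCongr (pow_succ' 2 k).symm)

theorem splitEquiv_lt (k : ℕ) (a a' : Fin 2) (b b' : Fin (2 ^ k)) :
    splitEquiv k (a, b) < splitEquiv k (a', b') ↔ a < a' ∨ a = a' ∧ b < b' := by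
  have h : ∀ (a : Fin 2) (b : Fin (2 ^ k)), (splitEquiv k (a, b) : ℕ) = b + 2 ^ k * a :=
    fun _ _ => rfl
  rw [Fin.lt_def, h, h]
  have hb := b.2
  have hb' := b'.2
  fin_cases a <;> fin_cases a' <;> simp <;> omega

theorem forall_split {k : ℕ} {p : Fin (2 ^ (k + 1)) → Prop} :
    (∀ l, p l) ↔ (∀ l, p (splitEquiv k (0, l))) ∧ ∀ l, p (splitEquiv k (1, l)) := by
  rw [← (splitEquiv k).forall_congr_right, Prod.forall, Fin.forall_fin_two]

theorem sum_split {k : ℕ} {M : Type*} [AddCommMonoid M] (f : Fin (2 ^ (k + 1)) → M) :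
    ∑ l, f l = ∑ l, f (splitEquiv k (0, l)) + ∑ l, f (splitEquiv k (1, l)) := by
  rw [← (splitEquiv k).sum_comp, Fintype.sum_prod_type, Fin.sum_univ_two]

section PolarOut

variable {m : ℕ}

/-- The columns of the product of the matrix with columns `u` and the polar matrix. -/
def polarOut (k : ℕ) (u : Fin (2 ^ k) → Fin m → ZMod 2) (j : Fin (2 ^ k)) : Fin m → ZMod 2 :=
  fun i => ∑ l, u l i * polarMatrix k l j

theorem polarOut_zero (u : Fin (2 ^ 0) → Fin m → ZMod 2) : polarOut 0 u = u := by
  funext j i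
  rw [show j = 0 from Subsingleton.elim (α := Fin 1) _ _]
  simp [polarOut, polarMatrix, Matrix.one_apply]

theorem polarMatrix_split (k : ℕ) (a a' : Fin 2) (b b' : Fin (2 ^ k)) :
    polarMatrix (k + 1) (splitEquiv k (a, b)) (splitEquiv k (a', b')) =
      kernelMatrix a a' * polarMatrix k b b' := by
  simp only [polarMatrix, Matrix.reindex_apply, Matrix.submatrix_apply]
  rw [← splitEquiv]
  simp [Matrix.kroneckerMap_apply]

/-- In blocks the matrix is `[[G, 0], [G, G]]`, so halves `(a, b)` are sent to `((a + b) G, b G)`.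
-/
theorem polarOut_split_zero (k : ℕ) (u : Fin (2 ^ (k + 1)) → Fin m → ZMod 2) (j : Fin (2 ^ k)) :
    polarOut (k + 1) u (splitEquiv k (0, j)) =
      polarOut k (fun l => u (splitEquiv k (0, l)) + u (splitEquiv k (1, l))) j := by
  funext i
  simp only [polarOut]
  rw [sum_split, ← Finset.sum_add_distrib]
  simp [polarMatrix_split, kernelMatrix, add_mul]

theorem polarOut_split_one (k : ℕ) (u : Fin (2 ^ (k + 1)) → Fin m → ZMod 2) (j : Fin (2 ^ k)) :
    polarOut (k + 1) u (splitEquiv k (1, j)) =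
      polarOut k (fun l => u (splitEquiv k (1, l))) j := by
  funext i
  simp only [polarOut]
  rw [sum_split]
  simp [polarMatrix_split, kernelMatrix]

/-- Used to see that knowing all outputs of the first half amounts to knowing all sums `U₁ + U₂`,
the side information of plus. -/
theorem polarOut_injective (k : ℕ) : Function.Injective (polarOut (m := m) k) := by
  induction k with
  | zero =>
    intro u u' h
    simpa only [polarOut_zero] using h
  | succ k ih =>
    intro u u' h
    have h1 := ih (funext fun j => by
      rw [← polarOut_split_one, ← polarOut_split_one, h] :
        polarOut k (fun l => u (splitEquiv k (1, l))) =
          polarOut k (fun l => u' (splitEquiv k (1, l))))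
    have h0 := ih (funext fun j => by
      rw [← polarOut_split_zero, ← polarOut_split_zero, h] :
        polarOut k (fun l => u (splitEquiv k (0, l)) + u (splitEquiv k (1, l))) =
          polarOut k (fun l => u' (splitEquiv k (0, l)) + u' (splitEquiv k (1, l))))
    have h1' := fun l => congrFun h1 l
    have h0' := fun l => congrFun h0 l
    funext l
    revert l
    rw [forall_split]
    refine ⟨fun l => ?_, h1'⟩
    have := h0' l
    rw [h1' l] at this
    exact add_right_cancel this

end PolarOut

/-! ### Independent copies, and their grouping into pairs. -/

section IidMass

variable {X Y ι : Type*} [Fintype X] [Fintype ι]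

/-- The mass function of independent elements with mass function `p`. -/
def iidMass {X : Type*} (ι : Type*) [Fintype ι] (p : X → ℝ) (z : ι → X) : ℝ := ∏ i, p (z i)

theorem push_equiv {Ω α : Type*} [Fintype Ω] (p : Ω → ℝ) (ρ : Ω ≃ α) (a : α) :
    push p ρ a = p (ρ.symm a) := by
  classical
  unfold push
  rw [Finset.sum_eq_single (ρ.symm a)]
  · simp
  · intro ω _ h
    rw [if_neg]
    rintro rfl
    simp at h
  · simp

theorem push_iidMass [DecidableEq ι] (p : X → ℝ) (ψ : X → Y) :
    push (iidMass ι p) (fun z i => ψ (z i)) = iidMass ι (push p ψ) := by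
  classical
  funext y
  simp only [push, iidMass]
  rw [Finset.prod_univ_sum, Fintype.piFinset_univ]
  refine Finset.sum_congr rfl fun z _ => ?_
  split_ifs with h
  · refine Finset.prod_congr rfl fun i _ => ?_
    rw [if_pos (congrFun h i)]
  · obtain ⟨i, hi⟩ := Function.ne_iff.1 h
    exact (Finset.prod_eq_zero (Finset.mem_univ i) (if_neg hi)).symm

/-- Pairing the entries of the two halves of a vector of length `2 ^ (k + 1)`. -/
def pairEquiv (X : Type*) (k : ℕ) : (Fin (2 ^ (k + 1)) → X) ≃ (Fin (2 ^ k) → X × X) where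
  toFun z i := (z (splitEquiv k (0, i)), z (splitEquiv k (1, i)))
  invFun z j := if ((splitEquiv k).symm j).1 = 0 then (z ((splitEquiv k).symm j).2).1
    else (z ((splitEquiv k).symm j).2).2
  left_inv z := by
    funext j
    revert j
    rw [forall_split]
    simp
  right_inv z := by
    funext i
    simp

theorem push_pairEquiv_iidMass (k : ℕ) (p : X → ℝ) :
    push (iidMass (Fin (2 ^ (k + 1))) p) (pairEquiv X k) = iidMass (Fin (2 ^ k)) (sqMass p) := by
  funext y
  obtain ⟨z, rfl⟩ := (pairEquiv X k).surjective y
  rw [push_equiv, Equiv.symm_apply_apply]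
  simp only [iidMass, sqMass, pairEquiv, Equiv.coe_fn_mk]
  rw [← (splitEquiv k).prod_comp, Fintype.prod_prod_type, Fin.prod_univ_two,
    Finset.prod_mul_distrib]

theorem iidMass_push_sqMass (k : ℕ) (p : X → ℝ) (ψ : X × X → Y) :
    iidMass (Fin (2 ^ k)) (push (sqMass p) ψ) = push (iidMass (Fin (2 ^ (k + 1))) p)
      (fun z i => ψ (z (splitEquiv k (0, i)), z (splitEquiv k (1, i)))) := by
  rw [← push_iidMass, ← push_pairEquiv_iidMass, push_push]
  rfl

end IidMass

/-! ### Iterated polarization steps and the columns they describe. -/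

namespace Source

section Leaf

variable {A : Type} [AddCommGroup A] [Fintype A]

/-- The source obtained by `k` polarization steps, chosen by the binary digits of the index. -/
noncomputable def leaf : (k : ℕ) → Source A → Fin (2 ^ k) → Source A
  | 0, W, _ => W
  | k + 1, W, j =>
    leaf k (if ((splitEquiv k).symm j).1 = 0 then W.minus else W.plus) ((splitEquiv k).symm j).2

theorem leaf_split_zero (k : ℕ) (W : Source A) (j : Fin (2 ^ k)) :
    leaf (k + 1) W (splitEquiv k (0, j)) = leaf k W.minus j := by
  simp [leaf]

theorem leaf_split_one (k : ℕ) (W : Source A) (j : Fin (2 ^ k)) :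
    leaf (k + 1) W (splitEquiv k (1, j)) = leaf k W.plus j := by
  simp [leaf]

/-- `leaf` branches at the root first; the potential argument needs the last step, which splits each
leaf. -/
theorem sum_leaf_succ (F : Source A → ℝ) (k : ℕ) (W : Source A) :
    ∑ j, F (leaf (k + 1) W j) = ∑ j, (F (leaf k W j).minus + F (leaf k W j).plus) := by
  induction k generalizing W with
  | zero =>
    rw [sum_split]
    simp only [leaf_split_zero, leaf_split_one]
    simp [leaf]
  | succ k ih =>
    rw [sum_split (fun j => F (leaf (k + 1 + 1) W j)),
      sum_split (fun j => F (leaf (k + 1) W j).minus + F (leaf (k + 1) W j).plus)]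
    simp only [leaf_split_zero, leaf_split_one]
    rw [ih, ih]

end Leaf

section PolarEntropy

variable {m : ℕ} {B : Type} [AddCommGroup B]

/-- The entropy, in nats, of `π` of the column `j` of the polar transform of independent copies of
a source, given all the side information and the preceding columns. -/
noncomputable def polarEnt (π : (Fin m → ZMod 2) →+ B) (k : ℕ) (W : Source (Fin m → ZMod 2))
    (j : Fin (2 ^ k)) : ℝ :=
  condShannon (iidMass (Fin (2 ^ k)) W.p) (fun z => π (polarOut k (fun i => (z i).2) j))
    (fun z => ((fun i => (z i).1), fun l : {l // l < j} => polarOut k (fun i => (z i).2) l))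

theorem past_eq_iff {k : ℕ} {V C : Type*} (j : Fin (2 ^ k)) (v v' : V) (y y' : Fin (2 ^ k) → C) :
    ((v, fun l : {l // l < j} => y l) = (v', fun l : {l // l < j} => y' l)) ↔
      v = v' ∧ ∀ l < j, y l = y' l := by
  simp [funext_iff]

/-- Pairing `2 ^ (k + 1)` copies of `W` gives `2 ^ k` copies of `W.minus` or `W.plus`. A first-half
column sees only minus sources; a second-half column has the whole first half in its past, which is
equivalent to all the sums. -/
theorem polarEnt_eq_leaf (π : (Fin m → ZMod 2) →+ B) (k : ℕ) (W : Source (Fin m → ZMod 2))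
    (j : Fin (2 ^ k)) : polarEnt π k W j = (leaf k W j).ent π := by
  induction k generalizing W with
  | zero =>
    have hp : push (iidMass (Fin (2 ^ 0)) W.p) (fun z => z 0) = W.p := by
      funext a
      exact (push_equiv _ (Equiv.funUnique (Fin 1) _) a).trans (by simp [iidMass])
    have h := condShannon_push (iidMass (Fin (2 ^ 0)) W.p) (fun z => z 0)
      (fun x => π x.2) Prod.fst
    rw [hp] at h
    change _ = W.ent π
    unfold ent polarEnt
    rw [h]
    have hj : j = 0 := Subsingleton.elim (α := Fin 1) _ _
    subst hj
    refine condShannon_congr _ (fun z z' _ => ?_) fun z z' => ?_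
    · rw [polarOut_zero, polarOut_zero]
    · rw [past_eq_iff]
      simp only [Fin.not_lt_zero, IsEmpty.forall_iff, implies_true, and_true]
      constructor
      · intro h
        exact congrFun h 0
      · intro h
        funext i
        rw [show i = 0 from Subsingleton.elim (α := Fin 1) _ _]
        exact h
  | succ k ih =>
    revert j
    rw [forall_split]
    constructor
    · intro j
      rw [leaf_split_zero, ← ih]
      have h : polarEnt π k W.minus j = condShannon
          (iidMass (X := (W.V × W.V) × (Fin m → ZMod 2)) (Fin (2 ^ k))
            (push (sqMass W.p) minusMap))
          (fun z => π (polarOut k (fun i => (z i).2) j))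
          (fun z => ((fun i => (z i).1),
            fun l : {l // l < j} => polarOut k (fun i => (z i).2) l)) := rfl
      rw [h, polarEnt, iidMass_push_sqMass, condShannon_push]
      refine condShannon_congr _ (fun z z' _ => ?_) fun z z' => ?_
      · rw [polarOut_split_zero, polarOut_split_zero]
        rfl
      · rw [past_eq_iff (V := Fin (2 ^ (k + 1)) → W.V)]
        refine Iff.trans ?_ (past_eq_iff _ _ _ _ _).symm
        rw [forall_split]
        simp only [splitEquiv_lt, polarOut_split_zero, minusMap, funext_iff (β := fun _ => W.V × W.V),
          Prod.mk.injEq]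
        rw [funext_iff, forall_split]
        simp [forall_and]
    · intro j
      rw [leaf_split_one, ← ih]
      have h : polarEnt π k W.plus j = condShannon
          (iidMass (X := ((W.V × W.V) × (Fin m → ZMod 2)) × (Fin m → ZMod 2)) (Fin (2 ^ k))
            (push (sqMass W.p) plusMap))
          (fun z => π (polarOut k (fun i => (z i).2) j))
          (fun z => ((fun i => (z i).1),
            fun l : {l // l < j} => polarOut k (fun i => (z i).2) l)) := rfl
      rw [h, polarEnt, iidMass_push_sqMass, condShannon_push]
      refine condShannon_congr _ (fun z z' _ => ?_) fun z z' => ?_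
      · rw [polarOut_split_one, polarOut_split_one]
        rfl
      · rw [past_eq_iff (V := Fin (2 ^ (k + 1)) → W.V)]
        refine Iff.trans ?_ (past_eq_iff _ _ _ _ _).symm
        rw [forall_split]
        simp only [splitEquiv_lt, polarOut_split_zero, polarOut_split_one, plusMap, minusMap,
          funext_iff (β := fun _ => (W.V × W.V) × (Fin m → ZMod 2)), Prod.mk.injEq]
        rw [funext_iff, forall_split]
        have hinj := (polarOut_injective (m := m) k).eq_iff
          (a := fun l => (z (splitEquiv k (0, l))).2 + (z (splitEquiv k (1, l))).2)
          (b := fun l => (z' (splitEquiv k (0, l))).2 + (z' (splitEquiv k (1, l))).2)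
        rw [funext_iff, funext_iff] at hinj
        simp [forall_and, hinj, and_assoc]

end PolarEntropy

/-! ### Convergence of the polarization process. -/

section Convergence

variable {A : Type} [AddCommGroup A] [Fintype A] {B : Type} [AddCommGroup B] [Fintype B]
  (π : A →+ B)

theorem tendsto_avg_sq_gap (W : Source A) :
    Tendsto (fun k : ℕ => (∑ j, ((leaf k W j).minus.ent π - (leaf k W j).ent π) ^ 2) / 2 ^ k)
      atTop (𝓝 0) := by
  set M : ℝ := ((Fintype.card B : ℕ) : ℝ)
  -- `2Mx - x²` is increasing on `[0, M]`, which suits a supermartingale, and its concavity produces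
  -- the squared increment.
  set φ : Source A → ℝ := fun W => 2 * M * W.ent π - W.ent π ^ 2 with hφ
  have hφ0 : ∀ W, 0 ≤ φ W := by
    intro W
    obtain ⟨h1, h2⟩ := W.ent_mem π
    simp only [hφ]
    nlinarith
  -- With `d` the minus increment, plus is at most `h - d`, and the potentials at `h + d` and `h -
  -- d` sum to exactly twice the potential at `h` minus `2d²`.
  have hstep : ∀ W : Source A,
      φ W.minus + φ W.plus ≤ 2 * (φ W - (W.minus.ent π - W.ent π) ^ 2) := by
    intro W
    have h1 := W.ent_minus_add_plus_le π
    have h2 := W.ent_le_minus π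
    have h3 := (W.plus.ent_mem π).1
    have h4 := (W.ent_mem π).2
    have h5 : W.plus.ent π ≤ 2 * W.ent π - W.minus.ent π := by linarith
    simp only [hφ]
    nlinarith [mul_nonneg (sub_nonneg.2 h5)
      (by linarith : 0 ≤ 2 * M - W.plus.ent π - (2 * W.ent π - W.minus.ent π))]
  set s : ℕ → ℝ := fun k => (∑ j, φ (leaf k W j)) / 2 ^ k with hs
  set t : ℕ → ℝ := fun k =>
    (∑ j, ((leaf k W j).minus.ent π - (leaf k W j).ent π) ^ 2) / 2 ^ k with ht
  have ht0 : ∀ k, 0 ≤ t k := fun k => by positivity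
  have hst : ∀ k, t k ≤ s k - s (k + 1) := by
    intro k
    have h : ∑ j, φ (leaf (k + 1) W j) ≤ 2 * (∑ j, φ (leaf k W j) -
        ∑ j, ((leaf k W j).minus.ent π - (leaf k W j).ent π) ^ 2) := by
      rw [sum_leaf_succ, ← Finset.sum_sub_distrib, Finset.mul_sum]
      exact Finset.sum_le_sum fun j _ => hstep _
    have h' : s (k + 1) ≤ s k - t k := by
      simp only [hs, ht]
      rw [← sub_div, pow_succ' (2 : ℝ) k, div_le_div_iff₀ (by positivity) (by positivity)]
      nlinarith [pow_pos (two_pos : (0 : ℝ) < 2) k]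
    linarith
  have hanti : Antitone s := antitone_nat_of_succ_le fun k => by linarith [hst k, ht0 k]
  have hlim := tendsto_atTop_ciInf hanti
    ⟨0, by rintro _ ⟨k, rfl⟩; exact div_nonneg (Finset.sum_nonneg fun j _ => hφ0 _) (by positivity)⟩
  have hdiff := hlim.sub (hlim.comp (tendsto_add_atTop_nat 1))
  rw [sub_self] at hdiff
  exact squeeze_zero ht0 hst hdiff

theorem tendsto_card_far {r : ℕ} (hB : Nat.card B = 2 ^ r) (W : Source A) {ε : ℝ} (hε : 0 < ε) :
    Tendsto (fun k : ℕ =>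
      ({j | ε < Metric.infDist ((leaf k W j).ent π) (logLevels r)} : Set (Fin (2 ^ k))).ncard /
        (2 : ℝ) ^ k) atTop (𝓝 0) := by
  classical
  obtain ⟨C, hC, h⟩ := exists_infDist_ent_le (A := A) π hB (half_pos hε)
  have hlim := (tendsto_avg_sq_gap π W).const_mul ((2 * C / ε) ^ 2)
  rw [mul_zero] at hlim
  refine squeeze_zero (fun k => by positivity) (fun k => ?_) hlim
  rw [← mul_div_assoc]
  refine div_le_div_of_nonneg_right ?_ (by positivity)
  rw [Set.ncard_eq_toFinset_card', Finset.card_eq_sum_ones, Nat.cast_sum, Finset.mul_sum]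
  refine (Finset.sum_le_sum fun j hj => ?_).trans
    (Finset.sum_le_sum_of_subset_of_nonneg (Finset.subset_univ _) fun j _ _ => by positivity)
  have hj' : ε < Metric.infDist ((leaf k W j).ent π) (logLevels r) := by simpa using hj
  have h1 := h (leaf k W j)
  -- Chebyshev's argument: a far leaf has increment above `ε / (2C)`, as `C` was chosen for `ε / 2`.
  have h2 : 1 ≤ 2 * C / ε * ((leaf k W j).minus.ent π - (leaf k W j).ent π) := by
    rw [div_mul_eq_mul_div, le_div_iff₀ hε]
    linarith
  rw [← mul_pow, Nat.cast_one]
  exact one_le_pow₀ h2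

end Convergence

end Source

theorem div_log_two_mem_nearIntegers {r : ℕ} {h ε : ℝ}
    (hh : Metric.infDist h (logLevels r) ≤ ε * Real.log 2) :
    h / Real.log 2 ∈ nearIntegers r ε := by
  have hcomp : IsCompact (logLevels r) := ((Set.finite_Iic r).image _).isCompact
  obtain ⟨_, ⟨t, ht, rfl⟩, hy⟩ := hcomp.exists_infDist_eq_dist ⟨_, 0, Nat.zero_le r, rfl⟩ h
  have hl : 0 < Real.log 2 := Real.log_pos one_lt_two
  rw [hy, Real.dist_eq, abs_le] at hh
  refine ⟨t, ht, ?_, ?_⟩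
  · rw [le_div_iff₀ hl]
    linarith [hh.1]
  · rw [div_le_iff₀ hl]
    linarith [hh.2]

/-! ### From random matrices to mass functions, and from nats to bits. -/

section Measures

theorem measureReal_preimage_eq_sum {Ω T : Type*} [MeasurableSpace Ω] [MeasurableSpace T]
    [Fintype T] [MeasurableSingletonClass T] (P : Measure Ω) [IsProbabilityMeasure P] {Z : Ω → T}
    (hZ : Measurable Z) (s : Set T) [DecidablePred (· ∈ s)] :
    P.real (Z ⁻¹' s) = ∑ t, if t ∈ s then P.real (Z ⁻¹' {t}) else 0 := by
  have h : ∀ u : Set T, P.real (Z ⁻¹' u) = (P.map Z).real u := fun u =>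
    (map_measureReal_apply hZ u.toFinite.measurableSet).symm
  have := Measure.isProbabilityMeasure_map (μ := P) hZ.aemeasurable
  simp only [h]
  rw [← Finset.sum_filter, sum_measureReal_singleton]
  congr 1
  ext t
  simp

theorem condEntropy_eq_condShannon {Ω T α β : Type*} [MeasurableSpace Ω] [MeasurableSpace T]
    [Fintype T] [MeasurableSingletonClass T] [Fintype α] [Fintype β] (P : Measure Ω)
    [IsProbabilityMeasure P] {Z : Ω → T} (hZ : Measurable Z) (f : T → α) (g : T → β) :
    condEntropy P (fun ω => f (Z ω)) (fun ω => g (Z ω)) =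
      condShannon (fun t => P.real (Z ⁻¹' {t})) f g / Real.log 2 := by
  classical
  set p : T → ℝ := fun t => P.real (Z ⁻¹' {t}) with hp
  have hp0 : ∀ t, 0 ≤ p t := fun t => measureReal_nonneg
  have h1 : ∀ x y, P.real ((fun ω => f (Z ω)) ⁻¹' {x} ∩ (fun ω => g (Z ω)) ⁻¹' {y}) =
      push p (fun t => (f t, g t)) (x, y) := by
    intro x y
    have := measureReal_preimage_eq_sum P hZ {t | f t = x ∧ g t = y}
    simp only [push, Prod.mk.injEq]
    convert this
    · ext ω; simp
    · simp
  have h2 : ∀ y, P.real ((fun ω => g (Z ω)) ⁻¹' {y}) = push p g y := by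
    intro y
    have := measureReal_preimage_eq_sum P hZ {t | g t = y}
    simp only [push]
    convert this
    · ext ω; simp
    · simp
  have h3 : ∀ y, push p g y = ∑ x, push p (fun t => (f t, g t)) (x, y) := by
    intro y
    rw [← push_snd_eq, push_push]
  have hl : Real.log 2 ≠ 0 := (Real.log_pos one_lt_two).ne'
  unfold condEntropy condShannon
  simp only [h1, h2, shannon_eq_sum]
  rw [Fintype.sum_prod_type, Finset.sum_comm, ← Finset.sum_sub_distrib, Finset.sum_div]
  refine Finset.sum_congr rfl fun y _ => ?_
  have hq0 : ∀ x, 0 ≤ push p (fun t => (f t, g t)) (x, y) := fun x => push_nonneg hp0 _ _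
  have hterm : ∀ x, push p (fun t => (f t, g t)) (x, y) / push p g y *
      Real.logb 2 (1 / (push p (fun t => (f t, g t)) (x, y) / push p g y)) * push p g y =
      (Real.negMulLog (push p (fun t => (f t, g t)) (x, y)) +
        push p (fun t => (f t, g t)) (x, y) * Real.log (push p g y)) / Real.log 2 := by
    intro x
    -- The zero case includes every `y` of probability zero, where the quotients take the default
    -- value 0.
    rcases (hq0 x).eq_or_lt with h | h
    · simp [← h]
    · have hy : 0 < push p g y := by
        rw [h3]
        exact h.trans_le (Finset.single_le_sum (f := fun x => push p (fun t => (f t, g t)) (x, y))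
          (fun x _ => hq0 x) (Finset.mem_univ x))
      rw [one_div_div, Real.logb, Real.log_div hy.ne' h.ne', Real.negMulLog]
      field_simp
      ring
  rw [Finset.sum_mul, Finset.sum_congr rfl fun x _ => hterm x, ← Finset.sum_div,
    Finset.sum_add_distrib, ← Finset.sum_mul, ← h3, Real.negMulLog]
  ring

/-- The source without side information and with the given law. -/
noncomputable def Source.ofMeasure {A : Type} [Fintype A] [MeasurableSpace A]
    [MeasurableSingletonClass A] (μ : Measure A) [IsProbabilityMeasure μ] : Source A where
  V := Unit
  p x := μ.real {x.2}
  mem := ⟨fun _ => measureReal_nonneg, by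
    rw [Fintype.sum_prod_type, Fintype.sum_unique, sum_measureReal_singleton]
    simp⟩

theorem iidMass_eq_measureReal {Ω A : Type*} [MeasurableSpace Ω] [Fintype A] [MeasurableSpace A]
    [MeasurableSingletonClass A] {μ : Measure A} {P : Measure Ω} {ι : Type*} [Fintype ι]
    {U : ι → Ω → A} (hmeas : ∀ j, Measurable (U j)) (hindep : iIndepFun U P)
    (hlaw : ∀ j, P.map (U j) = μ) (c : ι → A) :
    P.real ((fun ω j => U j ω) ⁻¹' {c}) = iidMass ι (fun a => μ.real {a}) c := by
  have h := hindep.measure_inter_preimage_eq_mul Finset.univ (sets := fun j => {c j})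
    fun j _ => measurableSet_singleton _
  have hset : (fun ω j => U j ω) ⁻¹' {c} = ⋂ i ∈ Finset.univ, U i ⁻¹' {c i} := by
    ext ω
    simp [funext_iff]
  rw [Measure.real, hset, h, ENNReal.toReal_prod, iidMass]
  refine Finset.prod_congr rfl fun j _ => ?_
  rw [Measure.real, ← hlaw j, Measure.map_apply (hmeas j) (measurableSet_singleton _)]

/-- The restriction of a vector to the coordinates in `S`. -/
def restrictHom {m : ℕ} (S : Finset (Fin m)) : (Fin m → ZMod 2) →+ (S → ZMod 2) where
  toFun u i := u i
  map_zero' := rfl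
  map_add' _ _ := rfl

theorem condEntropy_polar {m : ℕ} (μ : Measure (Fin m → ZMod 2)) [IsProbabilityMeasure μ]
    {Ω : Type*} [MeasurableSpace Ω] (P : Measure Ω) [IsProbabilityMeasure P] (k : ℕ)
    (X : Ω → Matrix (Fin m) (Fin (2 ^ k)) (ZMod 2))
    (hmeas : ∀ j, Measurable (fun ω => (X ω).col j))
    (hindep : iIndepFun (fun j ω => (X ω).col j) P)
    (hlaw : ∀ j, P.map (fun ω => (X ω).col j) = μ) (j : Fin (2 ^ k)) (S : Finset (Fin m)) :
    condEntropy P (colRestrict (fun ω => X ω * polarMatrix k) j S)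
        (pastCols (fun ω => X ω * polarMatrix k) j) =
      (Source.leaf k (Source.ofMeasure μ) j).ent (restrictHom S) / Real.log 2 := by
  have h := condEntropy_eq_condShannon P (Z := fun ω j => (X ω).col j) (measurable_pi_lambda _ hmeas)
    (fun u => restrictHom S (polarOut k u j)) (fun u (l : {l // l < j}) => polarOut k u l)
  refine Eq.trans h ?_
  congr 1
  have hfun : (fun c => P.real ((fun ω j => (X ω).col j) ⁻¹' {c})) =
      push (iidMass (Fin (2 ^ k)) (Source.ofMeasure μ).p) (fun z i => (z i).2) := by
    funext c
    rw [iidMass_eq_measureReal hmeas hindep hlaw, push_iidMass]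
    congr 1
    funext a
    exact ((push_snd_eq (α := Unit) (fun x => μ.real {x.2}) a).trans (Fintype.sum_unique _)).symm
  rw [hfun, condShannon_push, ← Source.polarEnt_eq_leaf, Source.polarEnt]
  refine condShannon_congr _ (fun _ _ _ => Iff.rfl) fun z z' => ?_
  rw [Source.past_eq_iff]
  have : (fun i => (z i).1) = fun i => (z' i).1 := funext fun _ => rfl
  simp [this, funext_iff]

end Measures

end MatrixPolar

theorem mainTheorem2 (m : ℕ) (μ : Measure (Fin m → ZMod 2)) [IsProbabilityMeasure μ]
    {Ω : ℕ → Type*} [∀ k, MeasurableSpace (Ω k)]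
    (P : (k : ℕ) → Measure (Ω k)) [∀ k, IsProbabilityMeasure (P k)]
    (X : (k : ℕ) → Ω k → Matrix (Fin m) (Fin (2 ^ k)) (ZMod 2))
    (hmeas : ∀ k, ∀ j : Fin (2 ^ k), Measurable (fun ω => (X k ω).col j))
    (hindep : ∀ k, iIndepFun (fun (j : Fin (2 ^ k)) ω => (X k ω).col j) (P k))
    (hlaw : ∀ k, ∀ j : Fin (2 ^ k), (P k).map (fun ω => (X k ω).col j) = μ)
    (ε : ℝ) (hε : 0 < ε) :
    Tendsto
      (fun k : ℕ =>
        ((MatrixPolar.polarizedCols (P k)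
          (fun ω => X k ω * MatrixPolar.polarMatrix k) ε).ncard : ℝ) / (2 : ℝ) ^ k)
      atTop (𝓝 1) := by
  classical
  have hl : 0 < Real.log 2 := Real.log_pos one_lt_two
  set far : (k : ℕ) → Finset (Fin m) → Set (Fin (2 ^ k)) := fun k S =>
    {j | ε * Real.log 2 < Metric.infDist
      ((MatrixPolar.Source.leaf k (MatrixPolar.Source.ofMeasure μ) j).ent
        (MatrixPolar.restrictHom S)) (MatrixPolar.logLevels S.card)} with hfar
  have hsum : Tendsto (fun k : ℕ => ∑ S, ((far k S).ncard : ℝ) / (2 : ℝ) ^ k) atTop (𝓝 0) := by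
    have h := tendsto_finsetSum (Finset.univ : Finset (Finset (Fin m))) fun S _ =>
      MatrixPolar.Source.tendsto_card_far (MatrixPolar.restrictHom S) (r := S.card) (by simp)
        (MatrixPolar.Source.ofMeasure μ) (mul_pos hε hl)
    rw [Finset.sum_const_zero] at h
    exact h
  have hlow := hsum.const_sub 1
  rw [sub_zero] at hlow
  refine tendsto_of_tendsto_of_tendsto_of_le_of_le hlow tendsto_const_nhds (fun k => ?_)
    fun k => ?_
  · set G := MatrixPolar.polarizedCols (P k) (fun ω => X k ω * MatrixPolar.polarMatrix k) ε
    -- Union bound: a column that is far for no `S` is polarized.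
    have hcov : (Set.univ : Set (Fin (2 ^ k))) ⊆
        G ∪ ⋃ S ∈ (Finset.univ : Finset (Finset (Fin m))), far k S := by
      intro j _
      by_cases hj : ∃ S, j ∈ far k S
      · exact Or.inr (by simpa using hj)
      · refine Or.inl fun S => ?_
        rw [MatrixPolar.condEntropy_polar μ (P k) k (X k) (hmeas k) (hindep k) (hlaw k)]
        exact MatrixPolar.div_log_two_mem_nearIntegers (not_lt.1 fun h => hj ⟨S, h⟩)
    have hcard := (Set.ncard_le_ncard hcov).trans (Set.ncard_union_le _ _)
    have hU := Finset.set_ncard_biUnion_le (Finset.univ : Finset (Finset (Fin m))) (far k)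
    rw [Set.ncard_univ, Nat.card_eq_fintype_card, Fintype.card_fin] at hcard
    have hreal : (2 : ℝ) ^ k ≤ G.ncard + ∑ S, ((far k S).ncard : ℝ) := by
      exact_mod_cast hcard.trans (Nat.add_le_add_left hU _)
    simp only
    rw [← Finset.sum_div, sub_le_iff_le_add, ← add_div, le_div_iff₀ (by positivity)]
    linarith
  · rw [div_le_one (by positivity)]
    have h := Set.ncard_le_card (MatrixPolar.polarizedCols (P k)
      (fun ω => X k ω * MatrixPolar.polarMatrix k) ε)
    rw [Nat.card_eq_fintype_card, Fintype.card_fin] at h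
    exact (Nat.cast_le.2 h).trans (by simp)
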